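/- Let $p$ be a prime and $m\ge 1$ with $q=p^m\equiv 5 \pmod 8$, let $\mathbb F_q$ be the field with $q$ elements, identify its additive group with $\mathbb Z_p^m$ by any fixed isomorphism, and let $\alpha$ be a generator of $\mathbb F_q^*$. Let $q=s^2+4t^2$ with $s,t\in\mathbb Z$, $\gcd(q,s)=1$ and $s\equiv 1\pmod 4$. Put $C_j=\alpha^j\langle\alpha^4\rangle$ for $j=0,1,2,3$ and $$t(\alpha)=\frac{16\,|(C_0+1)\cap C_3|-q-1-2s}{8}.$$ Let $$(A_1,B_1)=(C_0\cup C_1,\;C_1\cup C_3),\qquad (A_2,B_2)=(C_0\cup C_2,\;C_2\cup C_3).$$ For $i\in\{1,2\}$ let $\boldsymbol a_i,\boldsymbol b_i$ be the $\{0,1\}$ arrays on $\mathbb Z_p^m$ that are the indicator functions of $A_i,B_i$, and let $\boldsymbol s_i$ be the $\{0,1\}$ array on $\mathbb Z_2\times\mathbb Z_p^m$ that is the indicator function of $(\{0\}\times A_i)\cup(\{1\}\times B_i)$; when $t^2=1$, $\boldsymbol s_i$ is the equivalence class $i$ Ding–Helleseth–Martinsen array. For a $\{0,1\}$ array $\boldsymbol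 a=(a_g)$ on a finite abelian group $G$ of order $n$ with identity $e$, put $k=\sum_g a_g$, $C_{\boldsymbol a}(u)=\sum_g a_{gu}a_g$, and, in $\mathbb Z[G]$, $A=\sum_g a_g g$, $A^{(-1)}=\sum_g a_g g^{-1}$, $G=\sum_g g$. * $\boldsymbol a$ is *perfect* if for every $u\neq e$ the value $C_{\boldsymbol a}(u)$ is $k-\frac n4$, $k-\frac{n-1}4$, one of $k-\frac{n\pm2}4$ (the choice may depend on $u$), or $k-\frac{n+1}4$, according as $n\equiv 0,1,2,3\pmod 4$. * $\boldsymbol a$ is *symmetric* if $A=A^{(-1)}$, and *skew-symmetric* if $A+A^{(-1)}=G+e$ or $A+A^{(-1)}=G-e$. * A pair $(\boldsymbol a,\boldsymbol b)$ of $\{0,1\}$ arrays on $G$, with group ring elements $A,B$, is a *Legendre pair* if either $\sum_g a_g=\sum_g b_g=\frac{n+1}2$ and $AA^{(-1)}+BB^{(-1)}=(n+1)e+\frac{n+1}2(G-e)$, or $\sum_g a_g=\sum_g b_g=\frac{n-1}2$ and $AA^{(-1)}+BB^{(-1)}=(n-1)e+\frac{n-3}2(G-e)$. * A *Yamada–Pott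 $G$-array pair* is a Legendre pair in which one of the two arrays is symmetric and the other one is skew-symmetric. Then for each $i\in\{1,2\}$ the following are equivalent: 1. $\boldsymbol s_i$ is perfect; 2. $(\boldsymbol a_i,\boldsymbol b_i)$ is a Yamada–Pott $\mathbb Z_p^m$-array pair; 3. $t(\alpha)=(-1)^{i+1}$. -/

import Mathlib

namespace GArrays

section Arrays

variable {G : Type*} [AddCommGroup G] [Fintype G]

/-- The `{0,1}` `G`-array whose set of `1` indices is `D`. -/
noncomputable def arrayOf (D : Set G) : G → ℤ := D.indicator 1

/-- A `{0,1}` `G`-array (the finite abelian group `G` is written additively). -/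
def IsZeroOne (a : G → ℤ) : Prop := ∀ g, a g = 0 ∨ a g = 1

/-- Autocorrelation `C_a(t) = ∑_g a_{g+t} a_g` (the entries are real, so conjugation is omitted). -/
def autocorr (a : G → ℤ) (t : G) : ℤ := ∑ g, a (g + t) * a g

/-- Perfect `{0,1}` `G`-arrays, with `n = |G|` and `k = ∑_g a_g`. For `n ≡ 2 (mod 4)` each
nontrivial autocorrelation coefficient may take either of the two values. -/
def IsPerfect (a : G → ℤ) : Prop :=
  IsZeroOne a ∧ ∀ t : G, t ≠ 0 →
    let n : ℚ := Fintype.card G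
    let k : ℚ := ∑ g, (a g : ℚ)
    let c : ℚ := autocorr a t
    (Fintype.card G % 4 = 0 → c = k - n / 4) ∧
    (Fintype.card G % 4 = 1 → c = k - (n - 1) / 4) ∧
    (Fintype.card G % 4 = 2 → c = k - (n + 2) / 4 ∨ c = k - (n - 2) / 4) ∧
    (Fintype.card G % 4 = 3 → c = k - (n + 1) / 4)

/-- The element `A = ∑_g a_g g` of the group ring `ℤ[G]` corresponding to the array `a`. -/
noncomputable def toGroupRing (a : G → ℤ) : AddMonoidAlgebra ℤ G :=
  ∑ g, AddMonoidAlgebra.single g (a g)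

/-- `G = ∑_g g` in the group ring. -/
noncomputable def allG (G : Type*) [AddCommGroup G] [Fintype G] : AddMonoidAlgebra ℤ G :=
  ∑ g : G, AddMonoidAlgebra.single g 1

/-- `W^{(-1)} = ∑_g w_g g^{-1}` in the group ring. -/
noncomputable def starInv (W : AddMonoidAlgebra ℤ G) : AddMonoidAlgebra ℤ G :=
  AddMonoidAlgebra.mapDomain (fun g : G => -g) W

/-- Symmetric arrays: `A = A^{(-1)}`. -/
def IsSymm (a : G → ℤ) : Prop := toGroupRing a = starInv (toGroupRing a)

/-- Skew-symmetric arrays: `A + A^{(-1)} = G + e` or `A + A^{(-1)} = G - e`. -/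
def IsSkew (a : G → ℤ) : Prop :=
  toGroupRing a + starInv (toGroupRing a) = allG G + 1 ∨
  toGroupRing a + starInv (toGroupRing a) = allG G - 1

/-- Legendre `{0,1}` `G`-array pairs. The integer quotients below are exact. -/
def IsLegendrePair (a b : G → ℤ) : Prop :=
  let n : ℤ := Fintype.card G
  let A := toGroupRing a
  let B := toGroupRing b
  IsZeroOne a ∧ IsZeroOne b ∧ ∑ g, a g = ∑ g, b g ∧
  ((2 * ∑ g, a g = n + 1 ∧
      A * starInv A + B * starInv B =
        (2 * ((n + 1) / 2)) • (1 : AddMonoidAlgebra ℤ G) + ((n + 1) / 2) • (allG G - 1)) ∨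
   (2 * ∑ g, a g = n - 1 ∧
      A * starInv A + B * starInv B =
        (2 * ((n - 1) / 2)) • (1 : AddMonoidAlgebra ℤ G) + ((n - 3) / 2) • (allG G - 1)))

/-- Yamada-Pott `{0,1}` `G`-array pairs: Legendre pairs with `|A| = |B|`, one of whose two arrays
is symmetric and the other one skew-symmetric (in either order). -/
def IsYamadaPottPair (a b : G → ℤ) : Prop :=
  IsLegendrePair a b ∧ ∑ g, |a g| = ∑ g, |b g| ∧
  ((IsSymm a ∧ IsSkew b) ∨ (IsSkew a ∧ IsSymm b))

end Arrays

section Cyclotomy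

variable {F : Type*} [Field F]

/-- Cyclotomic class `C_i^{(d,q,α)} = α^i ⟨α^d⟩`, as a subset of the field. -/
def cycClass (d : ℕ) (α : Fˣ) (i : ℕ) : Set F :=
  {x | ∃ y ∈ Subgroup.zpowers (α ^ d), x = ((α ^ i * y : Fˣ) : F)}

/-- Cyclotomic number `(i,j) = |(C_i + 1) ∩ C_j|` of order `d`. -/
noncomputable def cycNumber (d : ℕ) (α : Fˣ) (i j : ℕ) : ℕ :=
  (((fun x => x + 1) '' cycClass d α i) ∩ cycClass d α j).ncard

/-- `t(α) = (16 (0,3) - q - 1 - 2 s) / 8`, with `q = |F|`. -/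
noncomputable def tOf (α : Fˣ) (s : ℤ) : ℚ :=
  (16 * (cycNumber 4 α 0 3 : ℚ) - (Nat.card F : ℚ) - 1 - 2 * (s : ℚ)) / 8

/-- The pair of sets `(A_i, B_i)` for `i = 1, 2` (no meaning is attached to other `i`). -/
def dhmSets (α : Fˣ) : ℕ → Set F × Set F
  | 1 => (cycClass 4 α 0 ∪ cycClass 4 α 1, cycClass 4 α 1 ∪ cycClass 4 α 3)
  | 2 => (cycClass 4 α 0 ∪ cycClass 4 α 2, cycClass 4 α 2 ∪ cycClass 4 α 3)
  | _ => (∅, ∅)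

end Cyclotomy

section DHM

variable {F : Type*} [Field F] {p m : ℕ}

/-- The array `a_i` on `ℤ_p^m`, under the identification `φ` of `(F, +)` with `ℤ_p^m`. -/
noncomputable def dhmA (φ : F ≃+ (Fin m → ZMod p)) (α : Fˣ) (i : ℕ) : (Fin m → ZMod p) → ℤ :=
  arrayOf (φ '' (dhmSets α i).1)

/-- The array `b_i` on `ℤ_p^m`. -/
noncomputable def dhmB (φ : F ≃+ (Fin m → ZMod p)) (α : Fˣ) (i : ℕ) : (Fin m → ZMod p) → ℤ :=
  arrayOf (φ '' (dhmSets α i).2)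

/-- The equivalence class `i` Ding-Helleseth-Martinsen array `s_i` on `ℤ_2 × ℤ_p^m`, whose set of
`1` indices is `({0} × A_i) ∪ ({1} × B_i)`. -/
noncomputable def dhmS (φ : F ≃+ (Fin m → ZMod p)) (α : Fˣ) (i : ℕ) :
    ZMod 2 × (Fin m → ZMod p) → ℤ :=
  arrayOf (({0} ×ˢ (φ '' (dhmSets α i).1)) ∪ ({1} ×ˢ (φ '' (dhmSets α i).2)))

end DHM

end GArrays

/-! Let `χ` be the quartic character with values in `ℤ[i]` sending `α` to `i`, and let `J =
jacobiSum χ χ = X + iY`. Indicators of unions of cyclotomic classes are combinations of `χ`, `χ²`,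
`χ³`, `χ⁴`, so all their correlations reduce to Jacobi sums (`sum_shift_quarticChar_mul`), hence to
`q`, `J` and its conjugate.

With `e = (-1)^i`, one of the two sets has a skew expansion and the other a symmetric one. At a
shift `u ≠ 0` their autocorrelations add up to `(2(q - 3) - χ(u)²(Y + 2e)) / 4`, where `χ(u)² = ±1`
takes both signs. Hence the Legendre condition, and also the weaker two-valued condition coming from
perfectness, forces `Y = -2e` and is implied by it (`flat_iff`, `nearly_flat_iff`). The remaining
requirements hold unconditionally: symmetry and skewness because `χ(-1) = -1`, and the
cross-correlation condition because the Jacobi sums cancel there (`two_mul_cross_sum`).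

The same calculus gives `16 (0,3) = q + 1 + 4Y - 2X`, so `t(α) = Y / 2` once `X = -s` is known. That
identity is arithmetic (`jacobiSum_re_eq`): `q = X² + Y²` is a proper representation, because `J`
reduces to plus or minus a binomial coefficient prime to `p`. Proper representations of a prime
power are essentially unique, and a congruence modulo 4 fixes the sign. -/

namespace GArrays

/-! ### The quartic character and its Jacobi sums. -/

section QuarticCharacter

variable {F : Type*} [Field F]

/-- The imaginary unit of `ℤ[i]`. -/
def gaussI : GaussianInt := ⟨0, 1⟩

lemma gaussI_sq : gaussI ^ 2 = -1 := by decide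

lemma gaussI_pow_four : gaussI ^ 4 = 1 := by decide

lemma gaussI_pow_mod (n : ℕ) : gaussI ^ n = gaussI ^ (n % 4) := by
  conv_lhs => rw [← Nat.div_add_mod n 4, pow_add, pow_mul, gaussI_pow_four, one_pow, one_mul]

lemma gaussI_pow_eq_one_iff (n : ℕ) : gaussI ^ n = 1 ↔ 4 ∣ n := by
  rw [gaussI_pow_mod, Nat.dvd_iff_mod_eq_zero]
  have h : n % 4 < 4 := Nat.mod_lt _ (by norm_num)
  generalize n % 4 = k at *
  interval_cases k <;> decide

variable {α : Fˣ} {χ : MulChar F GaussianInt}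

lemma quarticChar_pow (hχ : χ α = gaussI) (n : ℕ) : χ ((α : F) ^ n) = gaussI ^ n := by
  rw [map_pow, hχ]

lemma quarticChar_pow_ne_one (hχ : χ α = gaussI) {n : ℕ} (hn : ¬ 4 ∣ n) : χ ^ n ≠ 1 := by
  intro h
  have := congrArg (fun f : MulChar F GaussianInt => f α) h
  simp only [MulChar.pow_apply_coe, hχ, MulChar.one_apply_coe, gaussI_pow_eq_one_iff] at this
  exact hn this

variable [Fintype F]

lemma orderOf_generator {α : Fˣ} (hα : ∀ x : Fˣ, x ∈ Subgroup.zpowers α) :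
    orderOf α = Fintype.card F - 1 := by
  classical
  rw [orderOf_eq_card_of_forall_mem_zpowers hα, Nat.card_eq_fintype_card, Fintype.card_units]

lemma exists_quarticChar (hq : Fintype.card F % 8 = 5) {α : Fˣ}
    (hα : ∀ x : Fˣ, x ∈ Subgroup.zpowers α) :
    ∃ χ : MulChar F GaussianInt, χ α = gaussI := by
  classical
  let μ : GaussianIntˣ := ⟨gaussI, -gaussI, by decide, by decide⟩
  have hμ : μ ∈ rootsOfUnity (Fintype.card Fˣ) GaussianInt := by
    rw [mem_rootsOfUnity', Fintype.card_units]
    exact (gaussI_pow_eq_one_iff _).2 (by omega)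
  exact ⟨MulChar.ofRootOfUnity hμ hα, MulChar.ofRootOfUnity_spec hμ hα⟩

lemma exists_pow_generator (hα : ∀ x : Fˣ, x ∈ Subgroup.zpowers α) {x : F} (hx : x ≠ 0) :
    ∃ n : ℕ, x = (α : F) ^ n := by
  obtain ⟨n, hn⟩ := (mem_powers_iff_mem_zpowers (x := α)).2 (hα (Units.mk0 x hx))
  exact ⟨n, by rw [← Units.val_pow_eq_pow_val]; exact (congrArg Units.val hn).symm⟩

lemma quarticChar_values (hα : ∀ x : Fˣ, x ∈ Subgroup.zpowers α) (hχ : χ α = gaussI)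
    {x : F} (hx : x ≠ 0) : ∃ k < 4, χ x = gaussI ^ k := by
  obtain ⟨n, rfl⟩ := exists_pow_generator hα hx
  exact ⟨n % 4, Nat.mod_lt _ (by norm_num), by rw [quarticChar_pow hχ, gaussI_pow_mod]⟩

lemma quarticChar_pow_four (hα : ∀ x : Fˣ, x ∈ Subgroup.zpowers α) (hχ : χ α = gaussI)
    {x : F} (hx : x ≠ 0) : χ x ^ 4 = 1 := by
  obtain ⟨k, -, h⟩ := quarticChar_values hα hχ hx
  rw [h, ← pow_mul, gaussI_pow_eq_one_iff]
  exact Dvd.intro_left k rfl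

lemma mem_cycClass_iff (hα : ∀ x : Fˣ, x ∈ Subgroup.zpowers α) (hχ : χ α = gaussI)
    (x : F) (j : ℕ) : x ∈ cycClass 4 α j ↔ χ x = gaussI ^ j := by
  constructor
  · rintro ⟨y, hy, rfl⟩
    obtain ⟨n, rfl⟩ := (mem_powers_iff_mem_zpowers (x := α ^ 4)).2 hy
    simp only [Units.val_mul, Units.val_pow_eq_pow_val, map_mul, map_pow, hχ, gaussI_pow_four,
      one_pow, mul_one]
  · intro h
    have hx : x ≠ 0 := by
      rintro rfl
      rw [MulChar.map_zero] at h
      exact pow_ne_zero j (by decide) h.symm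
    obtain ⟨n, rfl⟩ := exists_pow_generator hα hx
    rw [quarticChar_pow hχ] at h
    have hdvd : 4 ∣ n + 3 * j := by
      rw [← gaussI_pow_eq_one_iff, pow_add, h, ← pow_add, gaussI_pow_eq_one_iff]
      exact ⟨j, by ring⟩
    obtain ⟨k, hk⟩ := hdvd
    -- From `n + 3j = 4k` one gets `n = j + 4(k - j)`; the exponent `k - j` may be negative, so it
    -- is an integer.
    refine ⟨(α ^ 4) ^ ((k : ℤ) - j), Subgroup.mem_zpowers_iff.2 ⟨_, rfl⟩, ?_⟩
    rw [← Units.val_pow_eq_pow_val]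
    congr 1
    rw [← zpow_natCast, ← zpow_natCast α 4, ← zpow_mul, ← zpow_natCast, ← zpow_add]
    congr 1
    push_cast
    omega

/-- Here `-1 = α ^ ((q - 1) / 2)`, and `q ≡ 5 (mod 8)` makes this exponent `2` modulo `4`. Negation
therefore exchanges `C₀` with `C₂` and `C₁` with `C₃`, the source of the symmetry and skewness
below. -/
lemma quarticChar_neg_one (hq : Fintype.card F % 8 = 5)
    (hα : ∀ x : Fˣ, x ∈ Subgroup.zpowers α) (hχ : χ α = gaussI) : χ (-1) = -1 := by
  have hord := orderOf_generator hα
  set h := (Fintype.card F - 1) / 2 with hh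
  have h1 : ((α : F) ^ h) ^ 2 = 1 := by
    rw [← pow_mul, ← Units.val_pow_eq_pow_val, show h * 2 = orderOf α by omega, pow_orderOf_eq_one,
      Units.val_one]
  have h2 : (α : F) ^ h ≠ 1 := by
    intro h3
    have h4 : α ^ h = 1 := Units.ext (by rw [Units.val_pow_eq_pow_val, h3, Units.val_one])
    have := Nat.le_of_dvd (by omega) (orderOf_dvd_of_pow_eq_one h4)
    omega
  rw [← (sq_eq_one_iff.1 h1).resolve_left h2, quarticChar_pow hχ, gaussI_pow_mod,
    show h % 4 = 2 by omega, gaussI_sq]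

/-- The substitution `x ↦ -u x` turns `x + u` into `u (1 - x)`. -/
lemma sum_shift_mul_eq_jacobiSum {R : Type*} [CommRing R] (χ ψ : MulChar F R) {u : F}
    (hu : u ≠ 0) :
    ∑ x, χ (x + u) * ψ x = χ u * ψ u * ψ (-1) * jacobiSum χ ψ := by
  rw [jacobiSum_comm, jacobiSum, Finset.mul_sum,
    ← Equiv.sum_comp (Equiv.mulLeft₀ (-u) (neg_ne_zero.2 hu))]
  refine Finset.sum_congr rfl fun x _ => ?_
  rw [Equiv.mulLeft₀_apply, show -u * x + u = u * (1 - x) by ring]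
  beta_reduce
  rw [show -u * x = u * (-1) * x by ring]
  simp only [map_mul]
  ring

/-- Substitute `x ↦ x⁻¹` and use `1 - x⁻¹ = -x⁻¹ (1 - x)`. It serves to express the Jacobi sums of
`χ²` with `χ` or `χ³` through `J` and its conjugate. -/
lemma jacobiSum_eq_neg_one_mul {R : Type*} [CommRing R] (χ ψ : MulChar F R) :
    jacobiSum χ ψ = ψ (-1) * jacobiSum (χ * ψ)⁻¹ ψ := by
  rw [jacobiSum, jacobiSum, Finset.mul_sum, ← Equiv.sum_comp (Equiv.inv F)]
  refine Finset.sum_congr rfl fun x _ => ?_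
  rcases eq_or_ne x 0 with rfl | hx
  · simp [MulChar.map_zero]
  rw [Equiv.inv_apply, show 1 - x⁻¹ = x⁻¹ * (-1 * (1 - x)) by field_simp; ring,
    MulChar.inv_apply']
  simp only [map_mul, MulChar.coeToFun_mul, Pi.mul_apply]
  ring

lemma quarticChar_mulChar_pow_four (hα : ∀ x : Fˣ, x ∈ Subgroup.zpowers α) (hχ : χ α = gaussI) :
    χ ^ 4 = 1 := by
  refine MulChar.ext fun x => ?_
  rw [MulChar.pow_apply_coe, quarticChar_pow_four hα hχ x.ne_zero, MulChar.one_apply_coe]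

lemma quarticChar_inv (hα : ∀ x : Fˣ, x ∈ Subgroup.zpowers α) (hχ : χ α = gaussI) :
    χ⁻¹ = χ ^ 3 :=
  inv_eq_of_mul_eq_one_left (by rw [← pow_succ, quarticChar_mulChar_pow_four hα hχ])

lemma quarticChar_star (hα : ∀ x : Fˣ, x ∈ Subgroup.zpowers α) (hχ : χ α = gaussI) :
    χ.ringHomComp (starRingEnd GaussianInt) = χ ^ 3 := by
  refine MulChar.ext fun x => ?_
  rw [MulChar.ringHomComp_apply, MulChar.pow_apply_coe]
  obtain ⟨k, hk, h⟩ := quarticChar_values hα hχ x.ne_zero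
  rw [h]
  interval_cases k <;> decide

lemma jacobiSum_star (hα : ∀ x : Fˣ, x ∈ Subgroup.zpowers α) (hχ : χ α = gaussI) :
    jacobiSum (χ ^ 3) (χ ^ 3) = star (jacobiSum χ χ) := by
  rw [← quarticChar_star hα hχ, jacobiSum_ringHomComp, starRingEnd_apply]

lemma jacobiSum_norm (hα : ∀ x : Fˣ, x ∈ Subgroup.zpowers α) (hχ : χ α = gaussI) :
    (Fintype.card F : ℤ) = (jacobiSum χ χ).re ^ 2 + (jacobiSum χ χ).im ^ 2 := by
  have hinj : Function.Injective GaussianInt.toComplex := fun a b h => by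
    simpa using h
  have key : jacobiSum χ χ * star (jacobiSum χ χ) = Fintype.card F := by
    apply hinj
    rw [← jacobiSum_star hα hχ, ← quarticChar_inv hα hχ, map_mul, map_natCast,
      ← jacobiSum_ringHomComp, ← jacobiSum_ringHomComp, ← MulChar.ringHomComp_inv]
    have h1 : χ.ringHomComp GaussianInt.toComplex ≠ 1 :=
      (MulChar.ringHomComp_ne_one_iff hinj).2
        (by simpa using quarticChar_pow_ne_one hχ (n := 1) (by norm_num))
    refine jacobiSum_mul_jacobiSum_inv ?_ h1 h1 ?_
    · rw [ringChar.eq_zero]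
      exact (CharP.ringChar_ne_zero_of_finite F).symm
    · rw [← MulChar.ringHomComp_mul]
      refine (MulChar.ringHomComp_ne_one_iff hinj).2 ?_
      rw [← sq]
      exact quarticChar_pow_ne_one hχ (by norm_num)
  have := congrArg Zsqrtd.re key
  simp at this
  linarith

/-- Each of the sixteen products is a Jacobi sum of powers of `χ`. Pairs involving the trivial
character give `-1` or `q - 2`, mutually inverse pairs give `-χ^a(-1)`, and the others are `±J` or
its conjugate up to sign. The constant term is carried by `χ⁴`, which unlike `1` vanishes at `0`. -/
lemma sum_shift_quarticChar_mul (hq : Fintype.card F % 8 = 5)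
    (hα : ∀ x : Fˣ, x ∈ Subgroup.zpowers α) (hχ : χ α = gaussI) {u : F} (hu : u ≠ 0)
    (c₁ c₂ c₃ c₄ d₁ d₂ d₃ d₄ : GaussianInt) :
    ∑ x, (c₁ * χ (x + u) + c₂ * χ (x + u) ^ 2 + c₃ * χ (x + u) ^ 3 + c₄ * χ (x + u) ^ 4) *
        (d₁ * χ x + d₂ * χ x ^ 2 + d₃ * χ x ^ 3 + d₄ * χ x ^ 4) =
      c₄ * d₄ * (Fintype.card F - 2) - c₂ * d₂ - c₁ * d₃ - c₃ * d₁
      + (c₄ * d₁ - c₁ * d₄) * χ u - (c₄ * d₂ + c₂ * d₄) * χ u ^ 2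
      + (c₄ * d₃ - c₃ * d₄) * χ u ^ 3
      + (c₂ * d₁ - c₁ * d₂) * χ u ^ 3 * jacobiSum χ χ - c₁ * d₁ * χ u ^ 2 * jacobiSum χ χ
      + (c₂ * d₃ - c₃ * d₂) * χ u * star (jacobiSum χ χ)
      - c₃ * d₃ * χ u ^ 2 * star (jacobiSum χ χ) := by
  have h4 := quarticChar_mulChar_pow_four hα hχ
  have hm := quarticChar_neg_one hq hα hχ
  have hu4 := quarticChar_pow_four hα hχ hu
  have hn (n : ℕ) (h : ¬ 4 ∣ n) : χ ^ n ≠ 1 := quarticChar_pow_ne_one hχ h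
  have hinv (a b : ℕ) (h : a + b = 4) : χ ^ b = (χ ^ a)⁻¹ :=
    (inv_eq_of_mul_eq_one_right (by rw [← pow_add, h, h4])).symm
  have T (a b : ℕ) (ha : a ≠ 0) (hb : b ≠ 0) : ∑ x, χ (x + u) ^ a * χ x ^ b =
      χ u ^ (a + b) * (-1) ^ b * jacobiSum (χ ^ a) (χ ^ b) := by
    have := sum_shift_mul_eq_jacobiSum (χ ^ a) (χ ^ b) hu
    simp only [MulChar.pow_apply' _ ha, MulChar.pow_apply' _ hb, hm] at this
    rw [this]; ring
  have one_b (b : ℕ) (hb : ¬ 4 ∣ b) : jacobiSum (χ ^ 4) (χ ^ b) = -1 := by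
    rw [h4, jacobiSum_one_nontrivial (hn b hb)]
  have one_a (b : ℕ) (hb : ¬ 4 ∣ b) : jacobiSum (χ ^ b) (χ ^ 4) = -1 := by
    rw [jacobiSum_comm, one_b b hb]
  have inv_ab (a b : ℕ) (h : a + b = 4) (ha : ¬ 4 ∣ a) :
      jacobiSum (χ ^ a) (χ ^ b) = -(-1) ^ a := by
    rw [hinv a b h, jacobiSum_nontrivial_inv (hn a ha), MulChar.pow_apply' _ (by omega), hm]
  have J11 : jacobiSum (χ ^ 1) (χ ^ 1) = jacobiSum χ χ := by rw [pow_one]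
  have J33 := jacobiSum_star hα hχ
  have J21 : jacobiSum (χ ^ 2) (χ ^ 1) = -jacobiSum χ χ := by
    rw [pow_one, jacobiSum_eq_neg_one_mul χ χ, hm, ← sq, ← hinv 2 2 rfl]; ring
  have J23 : jacobiSum (χ ^ 2) (χ ^ 3) = -star (jacobiSum χ χ) := by
    rw [← J33, jacobiSum_eq_neg_one_mul (χ ^ 3) (χ ^ 3), MulChar.pow_apply' _ (by norm_num), hm,
      ← pow_add, show 3 + 3 = 4 + 2 from rfl, pow_add, h4, one_mul, ← hinv 2 2 rfl]; ring
  have J44 : jacobiSum (χ ^ 4) (χ ^ 4) = (Fintype.card F : GaussianInt) - 2 := by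
    rw [h4, jacobiSum_one_one]
  have T11 := T 1 1 one_ne_zero one_ne_zero
  have T12 := T 1 2 one_ne_zero two_ne_zero
  have T13 := T 1 3 one_ne_zero three_ne_zero
  have T14 := T 1 4 one_ne_zero four_ne_zero
  have T21 := T 2 1 two_ne_zero one_ne_zero
  have T22 := T 2 2 two_ne_zero two_ne_zero
  have T23 := T 2 3 two_ne_zero three_ne_zero
  have T24 := T 2 4 two_ne_zero four_ne_zero
  have T31 := T 3 1 three_ne_zero one_ne_zero
  have T32 := T 3 2 three_ne_zero two_ne_zero
  have T33 := T 3 3 three_ne_zero three_ne_zero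
  have T34 := T 3 4 three_ne_zero four_ne_zero
  have T41 := T 4 1 four_ne_zero one_ne_zero
  have T42 := T 4 2 four_ne_zero two_ne_zero
  have T43 := T 4 3 four_ne_zero three_ne_zero
  have T44 := T 4 4 four_ne_zero four_ne_zero
  rw [J11] at T11
  rw [jacobiSum_comm, J21] at T12
  rw [inv_ab 1 3 rfl (by norm_num)] at T13
  rw [one_a 1 (by norm_num)] at T14
  rw [J21] at T21
  rw [inv_ab 2 2 rfl (by norm_num)] at T22
  rw [J23] at T23
  rw [one_a 2 (by norm_num)] at T24
  rw [inv_ab 3 1 rfl (by norm_num)] at T31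
  rw [jacobiSum_comm, J23] at T32
  rw [J33] at T33
  rw [one_a 3 (by norm_num)] at T34
  rw [one_b 1 (by norm_num)] at T41
  rw [one_b 2 (by norm_num)] at T42
  rw [one_b 3 (by norm_num)] at T43
  rw [J44] at T44
  simp only [pow_add, hu4] at T11 T12 T13 T14 T21 T22 T23 T24 T31 T32 T33 T34 T41 T42 T43 T44
  calc _ = c₁ * d₁ * ∑ x, χ (x + u) ^ 1 * χ x ^ 1 + c₁ * d₂ * ∑ x, χ (x + u) ^ 1 * χ x ^ 2
        + c₁ * d₃ * ∑ x, χ (x + u) ^ 1 * χ x ^ 3 + c₁ * d₄ * ∑ x, χ (x + u) ^ 1 * χ x ^ 4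
        + c₂ * d₁ * ∑ x, χ (x + u) ^ 2 * χ x ^ 1 + c₂ * d₂ * ∑ x, χ (x + u) ^ 2 * χ x ^ 2
        + c₂ * d₃ * ∑ x, χ (x + u) ^ 2 * χ x ^ 3 + c₂ * d₄ * ∑ x, χ (x + u) ^ 2 * χ x ^ 4
        + c₃ * d₁ * ∑ x, χ (x + u) ^ 3 * χ x ^ 1 + c₃ * d₂ * ∑ x, χ (x + u) ^ 3 * χ x ^ 2
        + c₃ * d₃ * ∑ x, χ (x + u) ^ 3 * χ x ^ 3 + c₃ * d₄ * ∑ x, χ (x + u) ^ 3 * χ x ^ 4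
        + c₄ * d₁ * ∑ x, χ (x + u) ^ 4 * χ x ^ 1 + c₄ * d₂ * ∑ x, χ (x + u) ^ 4 * χ x ^ 2
        + c₄ * d₃ * ∑ x, χ (x + u) ^ 4 * χ x ^ 3 + c₄ * d₄ * ∑ x, χ (x + u) ^ 4 * χ x ^ 4 := by
        simp only [Finset.mul_sum, ← Finset.sum_add_distrib]
        exact Finset.sum_congr rfl fun x _ => by ring
    _ = _ := by
        rw [T11, T12, T13, T14, T21, T22, T23, T24, T31, T32, T33, T34, T41, T42, T43, T44]
        linear_combination ((c₂ * d₃ - c₃ * d₂) * χ u * star (jacobiSum χ χ)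
          - c₃ * d₃ * χ u ^ 2 * star (jacobiSum χ χ)) * hu4

end QuarticCharacter

/-! ### Nondivisibility of the Jacobi sum and uniqueness of proper representations. -/

section ProperRepresentation

lemma mod_four_eq_one_of_pow_mod_eight {p m : ℕ} (h : p ^ m % 8 = 5) : p % 4 = 1 := by
  have hodd : p % 2 = 1 := by
    by_contra h2
    have hm : m ≠ 0 := by rintro rfl; simp at h
    have := (Nat.even_iff.2 (by omega : p % 2 = 0)).pow_of_ne_zero hm
    rw [Nat.even_iff] at this
    omega
  have hsq : p ^ 2 % 8 = 1 := by
    rw [Nat.pow_mod]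
    have h8 : p % 8 = 1 ∨ p % 8 = 3 ∨ p % 8 = 5 ∨ p % 8 = 7 := by omega
    rcases h8 with h8 | h8 | h8 | h8 <;> rw [h8]
  obtain ⟨k, rfl | rfl⟩ := m.even_or_odd'
  · rw [pow_mul, Nat.pow_mod, hsq, one_pow] at h
    omega
  · rw [pow_succ, pow_mul, Nat.mul_mod, Nat.pow_mod, hsq, one_pow] at h
    omega

/-- Kummer's theorem: adding `2f` and `f` in base `p` produces no carry. As `p^i ≡ 1 (mod 4)`, the
residues of `f` and `2f` modulo `p^i` are `g` and `2g` with `g = (p^i - 1) / 4`, and `3g < p^i`. -/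
lemma not_dvd_choose_three_mul {p m f : ℕ} (hp : p.Prime) (hp4 : p % 4 = 1)
    (hf : p ^ m = 4 * f + 1)
    (hf0 : 0 < f) : ¬ p ∣ (3 * f).choose f := by
  have hpow (i : ℕ) : p ^ i % 4 = 1 := by
    rw [Nat.pow_mod, hp4, one_pow, Nat.mod_eq_of_lt (by norm_num)]
  have hlog : Nat.log p (2 * f + f) < m := Nat.log_lt_of_lt_pow (by omega) (by omega)
  have h0 := Nat.factorization_choose' (n := 2 * f) (k := f) hp hlog
  rw [Finset.filter_false_of_mem, Finset.card_empty, show 2 * f + f = 3 * f by ring] at h0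
  · intro hdvd
    have := (hp.dvd_iff_one_le_factorization (Nat.choose_pos (by omega)).ne').1 hdvd
    omega
  · intro i hi
    rw [Finset.mem_Ico] at hi
    have hsplit : p ^ m = p ^ i * p ^ (m - i) := by rw [← pow_add]; congr 1; omega
    have h1 := hpow i
    have h2 := hpow (m - i)
    obtain ⟨g, hg⟩ : ∃ g, p ^ i = 4 * g + 1 := ⟨p ^ i / 4, by omega⟩
    obtain ⟨h, hh⟩ : ∃ h, p ^ (m - i) = 4 * h + 1 := ⟨p ^ (m - i) / 4, by omega⟩
    have hfg : f = g + p ^ i * h := by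
      rw [hsplit, hh] at hf
      nlinarith
    have e1 : f % p ^ i = g := by
      rw [hfg, Nat.add_mul_mod_self_left, Nat.mod_eq_of_lt (by omega)]
    have e2 : 2 * f % p ^ i = 2 * g := by
      rw [show 2 * f = 2 * g + p ^ i * (2 * h) by rw [hfg]; ring, Nat.add_mul_mod_self_left,
        Nat.mod_eq_of_lt (by omega)]
    omega

lemma sum_pow_of_pos {F : Type*} [Field F] [Fintype F] {j : ℕ} (hj : j ≠ 0) :
    ∑ x : F, x ^ j = if Fintype.card F - 1 ∣ j then -1 else 0 := by
  classical
  rw [← FiniteField.sum_pow_units, ← Finset.sum_erase Finset.univ (f := fun x : F => x ^ j) (a := 0)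
    (show (0 : F) ^ j = 0 from zero_pow hj)]
  symm
  refine Finset.sum_bij (fun x _ => (x : F)) (by simp) (fun x _ y _ h => Units.ext h) ?_
    (by simp)
  intro b hb
  exact ⟨Units.mk0 b (Finset.ne_of_mem_erase hb), Finset.mem_univ _, rfl⟩

lemma sum_pow_mul_one_sub_pow {F : Type*} [Field F] [Fintype F] {f : ℕ} (hf : 0 < f)
    (hF : Fintype.card F = 4 * f + 1) :
    ∑ x : F, x ^ (3 * f) * (1 - x) ^ (3 * f) = -((-1) ^ f * ((3 * f).choose f : F)) := by
  have h (x : F) : x ^ (3 * f) * (1 - x) ^ (3 * f) = ∑ k ∈ Finset.range (3 * f + 1),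
      (-1) ^ k * ((3 * f).choose k : F) * x ^ (3 * f + k) := by
    rw [show 1 - x = -x + 1 by ring, add_pow, Finset.mul_sum]
    refine Finset.sum_congr rfl fun k _ => ?_
    rw [neg_pow, one_pow, pow_add]
    ring
  simp_rw [h]
  rw [Finset.sum_comm]
  simp_rw [← Finset.mul_sum]
  rw [Finset.sum_eq_single f]
  -- The exponents `3f + k` run from `3f` to `6f`; the only multiple of `q - 1 = 4f` among them is
  -- `4f`, at `k = f`.
  · rw [sum_pow_of_pos (by omega), if_pos ⟨1, by omega⟩]
    ring
  · intro k hk hkf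
    rw [sum_pow_of_pos (by omega), if_neg, mul_zero]
    rintro ⟨c, hc⟩
    rw [Finset.mem_range] at hk
    rw [hF, Nat.add_sub_cancel] at hc
    have : c = 1 := by
      have h1 : 0 < c := Nat.pos_of_ne_zero (by rintro rfl; omega)
      have h2 : c < 2 := by
        by_contra! h2
        nlinarith
      omega
    subst this
    omega
  · intro h
    exact absurd (Finset.mem_range.2 (by omega)) h

/-- A ring homomorphism `ℤ[i] → F` sends `J` to plus or minus the binomial coefficient `(3f).choose
f`, which is nonzero in `F`; it would kill `J` if `p` divided both coordinates. -/
lemma not_dvd_jacobiSum {F : Type*} [Field F] [Fintype F] {p m : ℕ} (hp : p.Prime) [CharP F p]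
    (hF : Fintype.card F = p ^ m) (hq : p ^ m % 8 = 5) {α : Fˣ}
    (hα : ∀ x : Fˣ, x ∈ Subgroup.zpowers α) {χ : MulChar F GaussianInt} (hχ : χ α = gaussI) :
    ¬ ((p : ℤ) ∣ (jacobiSum χ χ).re ∧ (p : ℤ) ∣ (jacobiSum χ χ).im) := by
  obtain ⟨f, hf⟩ : ∃ f, p ^ m = 4 * f + 1 := ⟨p ^ m / 4, by omega⟩
  have hfpos : 0 < f := by omega
  have hord := orderOf_generator hα
  have hα4 : (α : F) ^ (4 * f) = 1 := by
    rw [← Units.val_pow_eq_pow_val, show 4 * f = orderOf α by omega, pow_orderOf_eq_one,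
      Units.val_one]
  have hα2 : (α : F) ^ (2 * f) = -1 := by
    refine (sq_eq_one_iff.1 (?_ : ((α : F) ^ (2 * f)) ^ 2 = 1)).resolve_left fun h3 => ?_
    · rw [← pow_mul, ← hα4]; congr 1; ring
    · have h4 : α ^ (2 * f) = 1 := Units.ext (by rw [Units.val_pow_eq_pow_val, h3, Units.val_one])
      have := Nat.le_of_dvd (by omega) (orderOf_dvd_of_pow_eq_one h4)
      omega
  -- The choice of square root of `-1` matters. With `α ^ f`, `χ` would reduce to `x ^ f` and the
  -- image of `J` would be a sum of a polynomial of degree `2f < q - 1`, which vanishes.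
  let r : { r : F // r * r = ((-1 : ℤ) : F) } := ⟨(α : F) ^ (3 * f), by
    rw [← pow_add, show 3 * f + 3 * f = 4 * f + 2 * f by ring, pow_add, hα4, hα2]; simp⟩
  let ψ : GaussianInt →+* F := Zsqrtd.lift r
  have hψ (z : GaussianInt) : ψ z = z.re + z.im * (α : F) ^ (3 * f) := rfl
  have hψI : ψ gaussI = (α : F) ^ (3 * f) := by rw [hψ]; simp [gaussI]
  have hψχ (x : F) : ψ (χ x) = x ^ (3 * f) := by
    rcases eq_or_ne x 0 with rfl | hx
    · rw [MulChar.map_zero, map_zero, zero_pow (by omega)]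
    · obtain ⟨n, rfl⟩ := exists_pow_generator hα hx
      rw [quarticChar_pow hχ, map_pow, hψI, ← pow_mul, ← pow_mul, mul_comm]
  have hJ : ψ (jacobiSum χ χ) = -((-1) ^ f * ((3 * f).choose f : F)) := by
    rw [← sum_pow_mul_one_sub_pow hfpos (by omega), jacobiSum, map_sum]
    simp_rw [map_mul, hψχ]
  rintro ⟨h1, h2⟩
  rw [hψ, (CharP.intCast_eq_zero_iff F p _).2 h1, (CharP.intCast_eq_zero_iff F p _).2 h2, zero_mul,
    add_zero, eq_comm, neg_eq_zero, mul_eq_zero] at hJ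
  rcases hJ with h | h
  · exact pow_ne_zero f (neg_ne_zero.2 one_ne_zero) h
  · exact not_dvd_choose_three_mul hp (mod_four_eq_one_of_pow_mod_eight hq) hf hfpos
      ((CharP.cast_eq_zero_iff F p _).1 h)

lemma eq_zero_of_dvd_of_sq_add_sq {q x y : ℤ} (hy : y ≠ 0) (hdvd : q ∣ x)
    (h : x ^ 2 + y ^ 2 = q ^ 2) : x = 0 := by
  obtain ⟨k, rfl⟩ := hdvd
  have hk : k ^ 2 < 1 := by
    by_contra! hk
    have h1 : 0 < y ^ 2 := by positivity
    nlinarith [mul_le_mul_of_nonneg_left hk (sq_nonneg q)]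
  rw [show k = 0 by nlinarith, mul_zero]

/-- The product of `ad - bc` and `ad + bc` is a multiple of `p^m`, and `p` cannot divide both
factors, so `p^m` divides one of them. By the two-squares identity that factor is a leg of `(ad ∓
bc)² + (ac ± bd)² = p^(2m)`, whose other leg is odd, hence nonzero; so the factor is `0`. -/
lemma sq_eq_sq_of_proper_representations {p : ℤ} (hp : Prime p) {m : ℕ} {a b c d : ℤ}
    (h2 : ¬ p ∣ 2) (hab : p ^ m = a ^ 2 + b ^ 2) (hcd : p ^ m = c ^ 2 + d ^ 2)
    (hm : m ≠ 0) (ha : ¬ p ∣ a) (hcd' : ¬ (p ∣ c ∧ p ∣ d)) (ha2 : Odd a) (hb2 : Even b)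
    (hc2 : Odd c) : a ^ 2 = c ^ 2 := by
  have hq0 : p ^ m ≠ 0 := pow_ne_zero m hp.ne_zero
  have hprod : (a * d - b * c) * (a * d + b * c) = p ^ m * (a ^ 2 - c ^ 2) := by
    linear_combination (-a ^ 2 ) * hcd + c ^ 2 * hab
  suffices h : (a * d - b * c) * (a * d + b * c) = 0 by
    rw [hprod] at h
    linarith [(mul_eq_zero.1 h).resolve_left hq0]
  rw [mul_eq_zero]
  have hnot : ¬ (p ∣ a * d - b * c ∧ p ∣ a * d + b * c) := by
    rintro ⟨h3, h4⟩
    have hd : p ∣ d := by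
      have h5 : p ∣ 2 * (a * d) := by
        rw [show 2 * (a * d) = (a * d - b * c) + (a * d + b * c) by ring]
        exact dvd_add h3 h4
      exact ((hp.dvd_or_dvd h5).resolve_left h2 |> hp.dvd_or_dvd).resolve_left ha
    refine hcd' ⟨hp.dvd_of_dvd_pow (n := 2) ?_, hd⟩
    rw [show c ^ 2 = p ^ m - d ^ 2 by linarith]
    exact dvd_sub (dvd_pow_self p hm) (dvd_pow hd two_ne_zero)
  rcases not_and_or.1 hnot with h | h
  · right
    refine eq_zero_of_dvd_of_sq_add_sq (q := p ^ m) (y := a * c - b * d) ?_ ?_ ?_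
    · have : Odd (a * c - b * d) := (ha2.mul hc2).sub_even (hb2.mul_right d)
      rintro h0
      simp [h0] at this
    · exact (hp.coprime_iff_not_dvd.2 h).pow_left.dvd_of_dvd_mul_left (hprod ▸ dvd_mul_right _ _)
    · linear_combination -(p ^ m) * hab - (a ^ 2 + b ^ 2) * hcd
  · left
    refine eq_zero_of_dvd_of_sq_add_sq (q := p ^ m) (y := a * c + b * d) ?_ ?_ ?_
    · have : Odd (a * c + b * d) := (ha2.mul hc2).add_even (hb2.mul_right d)
      rintro h0
      simp [h0] at this
    · exact (hp.coprime_iff_not_dvd.2 h).pow_left.dvd_of_dvd_mul_right (hprod ▸ dvd_mul_right _ _)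
    · linear_combination -(p ^ m) * hab - (a ^ 2 + b ^ 2) * hcd

end ProperRepresentation

/-! ### Character expansions of the indicators, and their correlations. -/

section Correlations

variable {F : Type*} [Field F] {α : Fˣ} {χ : MulChar F GaussianInt}

lemma gaussI_cube : gaussI ^ 3 = -gaussI := by decide

lemma gaussI_pow_six : gaussI ^ 6 = -1 := by decide

lemma gaussI_pow_nine : gaussI ^ 9 = gaussI := by decide

lemma gaussianInt_eq_add_mul_gaussI (z : GaussianInt) :
    z = (z.re : GaussianInt) + z.im * gaussI := by
  ext <;> simp [gaussI]

lemma star_gaussianInt_eq (z : GaussianInt) :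
    star z = (z.re : GaussianInt) - z.im * gaussI := by
  ext <;> simp [gaussI]

lemma intCast_gaussianInt_injective : Function.Injective (Int.cast : ℤ → GaussianInt) :=
  Int.cast_injective

/-- Four times `P` is `2 χ⁴ - e (1 - i) χ - e (1 + i) χ³`. For `e = -1` (`e = 1`) this is the
indicator function of `C₀ ∪ C₁` (of `C₂ ∪ C₃`). -/
def HasSkewExpansion (χ : MulChar F GaussianInt) (e : ℤ) (P : F → ℤ) : Prop :=
  ∀ x, 4 * (P x : GaussianInt) = -e * (1 - gaussI) * χ x + 0 * χ x ^ 2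
    + -e * (1 + gaussI) * χ x ^ 3 + 2 * χ x ^ 4

/-- Twice `Q` is `χ⁴ + e χ²`. For `e = -1` (`e = 1`) this is the indicator function of `C₁ ∪ C₃`
(of `C₀ ∪ C₂`). -/
def HasSymmExpansion (χ : MulChar F GaussianInt) (e : ℤ) (Q : F → ℤ) : Prop :=
  ∀ x, 2 * (Q x : GaussianInt) = 0 * χ x + e * χ x ^ 2 + 0 * χ x ^ 3 + 1 * χ x ^ 4

variable {e : ℤ} {P Q : F → ℤ}

lemma HasSkewExpansion.apply_zero (hP : HasSkewExpansion χ e P) : P 0 = 0 := by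
  have := hP 0
  simp only [MulChar.map_zero] at this
  norm_num at this
  exact this

lemma HasSymmExpansion.apply_zero (hQ : HasSymmExpansion χ e Q) : Q 0 = 0 := by
  have := hQ 0
  simp only [MulChar.map_zero] at this
  norm_num at this
  exact this

variable [Fintype F]

lemma quarticChar_sq_eq (hα : ∀ x : Fˣ, x ∈ Subgroup.zpowers α) (hχ : χ α = gaussI)
    {u : F} (hu : u ≠ 0) : χ u ^ 2 = (((χ u ^ 2).re : ℤ) : GaussianInt) ∧
      ((χ u ^ 2).re = 1 ∨ (χ u ^ 2).re = -1) := by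
  obtain ⟨k, hk, h⟩ := quarticChar_values hα hχ hu
  rw [h]
  interval_cases k <;> decide

lemma sum_quarticChar (hα : ∀ x : Fˣ, x ∈ Subgroup.zpowers α) (hχ : χ α = gaussI)
    (c₁ c₂ c₃ c₄ : GaussianInt) :
    ∑ x, (c₁ * χ x + c₂ * χ x ^ 2 + c₃ * χ x ^ 3 + c₄ * χ x ^ 4) =
      c₄ * (Fintype.card F - 1) := by
  classical
  have h0 (n : ℕ) (hn : ¬ 4 ∣ n) : ∑ x, χ x ^ n = 0 := by
    rw [← MulChar.sum_eq_zero_of_ne_one (quarticChar_pow_ne_one hχ hn)]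
    refine Finset.sum_congr rfl fun x _ => (MulChar.pow_apply' _ ?_ x).symm
    rintro rfl
    exact hn (dvd_zero 4)
  have h4 : ∑ x, χ x ^ 4 = (Fintype.card F : GaussianInt) - 1 := by
    rw [← Finset.sum_erase Finset.univ (f := fun x => χ x ^ 4) (a := 0)
        (by simp [MulChar.map_zero]),
      Finset.sum_congr rfl fun x hx => quarticChar_pow_four hα hχ (Finset.ne_of_mem_erase hx),
      Finset.sum_const, Finset.card_erase_of_mem (Finset.mem_univ _), Finset.card_univ,
      nsmul_eq_mul, mul_one, Nat.cast_sub Fintype.card_pos, Nat.cast_one]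
  have h1 := h0 1 (by norm_num)
  simp only [pow_one] at h1
  simp only [Finset.sum_add_distrib, ← Finset.mul_sum, h1, h0 2 (by norm_num),
    h0 3 (by norm_num), h4]
  ring

lemma sum_skew_mul_skew (hq : Fintype.card F % 8 = 5)
    (hα : ∀ x : Fˣ, x ∈ Subgroup.zpowers α) (hχ : χ α = gaussI) (he : e ^ 2 = 1)
    (hP : HasSkewExpansion χ e P) {u : F} (hu : u ≠ 0) :
    4 * ∑ x, P (x + u) * P x = Fintype.card F - 3 - (χ u ^ 2).re * (jacobiSum χ χ).im := by
  have key := sum_shift_quarticChar_mul hq hα hχ hu (-e * (1 - gaussI)) 0 (-e * (1 + gaussI)) 2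
    (-e * (1 - gaussI)) 0 (-e * (1 + gaussI)) 2
  have hsq := (quarticChar_sq_eq hα hχ hu).1
  simp only [← hP _] at key
  rw [star_gaussianInt_eq] at key
  nth_rw 1 2 [gaussianInt_eq_add_mul_gaussI (jacobiSum χ χ)] at key
  have heG : (e : GaussianInt) ^ 2 = 1 := by exact_mod_cast he
  have hI := gaussI_sq
  have : 4 * ((4 * ∑ x, P (x + u) * P x : ℤ) : GaussianInt) = 4 *
      ((Fintype.card F - 3 - (χ u ^ 2).re * (jacobiSum χ χ).im : ℤ) : GaussianInt) := by
    push_cast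
    rw [← hsq]
    have h (x : F) : 4 * (P (x + u) : GaussianInt) * (4 * P x) = 16 * (P (x + u) * P x) := by ring
    simp only [h, ← Finset.mul_sum] at key
    linear_combination key + (2 * e ^ 2 - χ u ^ 2 * e ^ 2 * (2 * (jacobiSum χ χ).re
      - 4 * (jacobiSum χ χ).im)) * hI - (4 + 4 * (jacobiSum χ χ).im * χ u ^ 2) * heG
  exact_mod_cast mul_left_cancel₀ (by norm_num) this

lemma sum_symm_mul_symm (hq : Fintype.card F % 8 = 5)
    (hα : ∀ x : Fˣ, x ∈ Subgroup.zpowers α) (hχ : χ α = gaussI) (he : e ^ 2 = 1)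
    (hQ : HasSymmExpansion χ e Q) {u : F} (hu : u ≠ 0) :
    4 * ∑ x, Q (x + u) * Q x = Fintype.card F - 3 - 2 * e * (χ u ^ 2).re := by
  have key := sum_shift_quarticChar_mul hq hα hχ hu 0 e 0 1 0 e 0 1
  have hsq := (quarticChar_sq_eq hα hχ hu).1
  simp only [← hQ _] at key
  have heG : (e : GaussianInt) ^ 2 = 1 := by exact_mod_cast he
  apply intCast_gaussianInt_injective
  push_cast
  rw [← hsq, Finset.mul_sum]
  have h (x : F) : 4 * ((Q (x + u) : GaussianInt) * Q x) = 2 * Q (x + u) * (2 * Q x) := by ring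
  simp only [h, key]
  linear_combination -heG

/-- The terms with a Jacobi sum, and those linear or cubic in `χ u`, change sign when the two
functions are exchanged, so they cancel in the sum of both orders. -/
lemma sum_skew_mul_symm_add (hq : Fintype.card F % 8 = 5)
    (hα : ∀ x : Fˣ, x ∈ Subgroup.zpowers α) (hχ : χ α = gaussI)
    (hP : HasSkewExpansion χ e P) (hQ : HasSymmExpansion χ e Q) {u : F} (hu : u ≠ 0) :
    2 * (∑ x, P (x + u) * Q x + ∑ x, Q (x + u) * P x) =
      Fintype.card F - 2 - e * (χ u ^ 2).re := by
  have key₁ := sum_shift_quarticChar_mul hq hα hχ hu (-e * (1 - gaussI)) 0 (-e * (1 + gaussI)) 2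
    0 e 0 1
  have key₂ := sum_shift_quarticChar_mul hq hα hχ hu 0 e 0 1
    (-e * (1 - gaussI)) 0 (-e * (1 + gaussI)) 2
  have hsq := (quarticChar_sq_eq hα hχ hu).1
  simp only [← hP _, ← hQ _] at key₁ key₂
  have h (x : F) : 4 * (P (x + u) : GaussianInt) * (2 * Q x) = 8 * (P (x + u) * Q x) := by ring
  have h' (x : F) : 2 * (Q (x + u) : GaussianInt) * (4 * P x) = 8 * (Q (x + u) * P x) := by ring
  simp only [h, h', ← Finset.mul_sum] at key₁ key₂
  have : 4 * ((2 * (∑ x, P (x + u) * Q x + ∑ x, Q (x + u) * P x) : ℤ) : GaussianInt) = 4 *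
      ((Fintype.card F - 2 - e * (χ u ^ 2).re : ℤ) : GaussianInt) := by
    push_cast
    rw [← hsq]
    linear_combination key₁ + key₂
  exact_mod_cast mul_left_cancel₀ (by norm_num) this

lemma sum_skew (hα : ∀ x : Fˣ, x ∈ Subgroup.zpowers α) (hχ : χ α = gaussI)
    (hP : HasSkewExpansion χ e P) : 2 * ∑ x, P x = Fintype.card F - 1 := by
  have key := sum_quarticChar hα hχ (-e * (1 - gaussI)) 0 (-e * (1 + gaussI)) 2
  simp only [← hP _, ← Finset.mul_sum] at key
  have : 2 * ((2 * ∑ x, P x : ℤ) : GaussianInt) = 2 * ((Fintype.card F - 1 : ℤ) : GaussianInt) := by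
    push_cast
    linear_combination key
  exact_mod_cast mul_left_cancel₀ two_ne_zero this

lemma sum_symm (hα : ∀ x : Fˣ, x ∈ Subgroup.zpowers α) (hχ : χ α = gaussI)
    (hQ : HasSymmExpansion χ e Q) : 2 * ∑ x, Q x = Fintype.card F - 1 := by
  have key := sum_quarticChar hα hχ 0 e 0 1
  simp only [← hQ _, ← Finset.mul_sum] at key
  apply intCast_gaussianInt_injective
  push_cast
  linear_combination key

lemma sum_skew_mul_symm (hα : ∀ x : Fˣ, x ∈ Subgroup.zpowers α) (hχ : χ α = gaussI)
    (hP : HasSkewExpansion χ e P) (hQ : HasSymmExpansion χ e Q) :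
    4 * ∑ x, P x * Q x = Fintype.card F - 1 := by
  -- These are the coefficients of the product of the two expansions, reduced by `χ⁴ = 1` off zero.
  have key := sum_quarticChar hα hχ (-e * (1 - gaussI) - e * e * (1 + gaussI)) (2 * e)
    (-e * (1 + gaussI) - e * e * (1 - gaussI)) 2
  have h (x : F) : 8 * ((P x : GaussianInt) * Q x) =
      (-e * (1 - gaussI) - e * e * (1 + gaussI)) * χ x + (2 * e) * χ x ^ 2
      + (-e * (1 + gaussI) - e * e * (1 - gaussI)) * χ x ^ 3 + 2 * χ x ^ 4 := by
    rw [show 8 * ((P x : GaussianInt) * Q x) = 4 * P x * (2 * Q x) by ring, hP x, hQ x]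
    rcases eq_or_ne x 0 with rfl | hx
    · simp [MulChar.map_zero]
    · have h4 := quarticChar_pow_four hα hχ hx
      generalize χ x = θ at *
      linear_combination (-e * (1 - gaussI) * θ - e * e * (1 + gaussI) * θ + 2 * e * θ ^ 2
        - e * (1 + gaussI) * θ ^ 3 + 2 * θ ^ 4) * h4
  simp only [← h, ← Finset.mul_sum] at key
  have : 2 * ((4 * ∑ x, P x * Q x : ℤ) : GaussianInt) =
      2 * ((Fintype.card F - 1 : ℤ) : GaussianInt) := by
    push_cast
    linear_combination key
  exact_mod_cast mul_left_cancel₀ two_ne_zero this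

lemma quarticChar_neg (hq : Fintype.card F % 8 = 5)
    (hα : ∀ x : Fˣ, x ∈ Subgroup.zpowers α) (hχ : χ α = gaussI) (x : F) : χ (-x) = -χ x := by
  rw [← neg_one_mul x, map_mul, quarticChar_neg_one hq hα hχ, neg_one_mul]

lemma HasSymmExpansion.neg_apply (hq : Fintype.card F % 8 = 5)
    (hα : ∀ x : Fˣ, x ∈ Subgroup.zpowers α) (hχ : χ α = gaussI)
    (hQ : HasSymmExpansion χ e Q) (x : F) : Q (-x) = Q x := by
  have h := quarticChar_neg hq hα hχ x
  have : 2 * (Q (-x) : GaussianInt) = 2 * Q x := by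
    rw [hQ, hQ, h]; ring
  exact_mod_cast mul_left_cancel₀ two_ne_zero this

lemma HasSkewExpansion.add_neg_apply (hq : Fintype.card F % 8 = 5)
    (hα : ∀ x : Fˣ, x ∈ Subgroup.zpowers α) (hχ : χ α = gaussI)
    (hP : HasSkewExpansion χ e P) {x : F} (hx : x ≠ 0) : P x + P (-x) = 1 := by
  have h := quarticChar_neg hq hα hχ x
  have : 4 * ((P x + P (-x) : ℤ) : GaussianInt) = 4 * (1 : ℤ) := by
    push_cast
    rw [mul_add, hP, hP, h]
    linear_combination 4 * quarticChar_pow_four hα hχ hx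
  exact_mod_cast mul_left_cancel₀ (by norm_num) this

/-- Fourier inversion on the quotient by fourth powers: the coefficient of `χ^k` is `i^(-jk)`,
written with a nonnegative exponent. -/
lemma indicator_cycClass_expansion (hα : ∀ x : Fˣ, x ∈ Subgroup.zpowers α) (hχ : χ α = gaussI)
    (j : ℕ) (hj : j < 4) (x : F) :
    4 * (((cycClass 4 α j).indicator 1 x : ℤ) : GaussianInt) = gaussI ^ (3 * j) * χ x +
      gaussI ^ (2 * j) * χ x ^ 2 + gaussI ^ j * χ x ^ 3 + 1 * χ x ^ 4 := by
  classical
  rw [Set.indicator_apply, Pi.one_apply]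
  simp only [mem_cycClass_iff hα hχ]
  rcases eq_or_ne x 0 with rfl | hx
  · rw [MulChar.map_zero, if_neg (pow_ne_zero j (by decide)).symm]
    simp
  · obtain ⟨k, hk, h⟩ := quarticChar_values hα hχ hx
    rw [h]
    interval_cases j <;> interval_cases k <;> split_ifs with hh <;> revert hh <;> decide

lemma disjoint_cycClass (hα : ∀ x : Fˣ, x ∈ Subgroup.zpowers α) (hχ : χ α = gaussI)
    {i j : ℕ} (h : gaussI ^ i ≠ gaussI ^ j) : Disjoint (cycClass 4 α i) (cycClass 4 α j) := by
  rw [Set.disjoint_left]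
  intro x hx hx'
  rw [mem_cycClass_iff hα hχ] at hx hx'
  exact h (hx.symm.trans hx')

lemma indicator_union_cycClass (hα : ∀ x : Fˣ, x ∈ Subgroup.zpowers α) (hχ : χ α = gaussI)
    {i j : ℕ} (h : gaussI ^ i ≠ gaussI ^ j) (x : F) :
    (cycClass 4 α i ∪ cycClass 4 α j).indicator (1 : F → ℤ) x =
      (cycClass 4 α i).indicator 1 x + (cycClass 4 α j).indicator 1 x := by
  rw [Set.indicator_union_of_disjoint (disjoint_cycClass hα hχ h)]

lemma indicator_one_skew (hα : ∀ x : Fˣ, x ∈ Subgroup.zpowers α) (hχ : χ α = gaussI) :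
    HasSkewExpansion χ (-1) ((dhmSets α 1).1.indicator 1) := by
  intro x
  rw [dhmSets, indicator_union_cycClass hα hχ (by decide), Int.cast_add, mul_add,
    indicator_cycClass_expansion hα hχ 0 (by norm_num),
    indicator_cycClass_expansion hα hχ 1 (by norm_num)]
  linear_combination χ x * gaussI_cube + χ x ^ 2 * gaussI_sq

lemma indicator_one_symm (hα : ∀ x : Fˣ, x ∈ Subgroup.zpowers α) (hχ : χ α = gaussI) :
    HasSymmExpansion χ (-1) ((dhmSets α 1).2.indicator 1) := by
  intro x
  apply mul_left_cancel₀ (two_ne_zero (α := GaussianInt))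
  rw [← mul_assoc, show (2 * 2 : GaussianInt) = 4 by norm_num, dhmSets,
    indicator_union_cycClass hα hχ (by decide), Int.cast_add, mul_add,
    indicator_cycClass_expansion hα hχ 1 (by norm_num),
    indicator_cycClass_expansion hα hχ 3 (by norm_num)]
  linear_combination χ x * (gaussI_cube + gaussI_pow_nine) + χ x ^ 2 * (gaussI_sq + gaussI_pow_six)
    + χ x ^ 3 * gaussI_cube

lemma indicator_two_skew (hα : ∀ x : Fˣ, x ∈ Subgroup.zpowers α) (hχ : χ α = gaussI) :
    HasSkewExpansion χ 1 ((dhmSets α 2).2.indicator 1) := by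
  intro x
  rw [dhmSets, indicator_union_cycClass hα hχ (by decide), Int.cast_add, mul_add,
    indicator_cycClass_expansion hα hχ 2 (by norm_num),
    indicator_cycClass_expansion hα hχ 3 (by norm_num)]
  linear_combination χ x * (gaussI_pow_six + gaussI_pow_nine)
    + χ x ^ 2 * (gaussI_pow_four + gaussI_pow_six) + χ x ^ 3 * (gaussI_sq + gaussI_cube)

lemma indicator_two_symm (hα : ∀ x : Fˣ, x ∈ Subgroup.zpowers α) (hχ : χ α = gaussI) :
    HasSymmExpansion χ 1 ((dhmSets α 2).1.indicator 1) := by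
  intro x
  apply mul_left_cancel₀ (two_ne_zero (α := GaussianInt))
  rw [← mul_assoc, show (2 * 2 : GaussianInt) = 4 by norm_num, dhmSets,
    indicator_union_cycClass hα hχ (by decide), Int.cast_add, mul_add,
    indicator_cycClass_expansion hα hχ 0 (by norm_num),
    indicator_cycClass_expansion hα hχ 2 (by norm_num)]
  linear_combination χ x * gaussI_pow_six + χ x ^ 2 * gaussI_pow_four + χ x ^ 3 * gaussI_sq

lemma cycNumber_eq_sum (d : ℕ) (α : Fˣ) (i j : ℕ) :
    (cycNumber d α i j : ℤ) =
      ∑ x : F, (cycClass d α j).indicator 1 (x + 1) * (cycClass d α i).indicator 1 x := by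
  classical
  have h : ((fun x : F => x + 1) '' cycClass d α i) ∩ cycClass d α j =
      (fun x : F => x + 1) '' {x | x + 1 ∈ cycClass d α j ∧ x ∈ cycClass d α i} := by
    ext y
    simp only [Set.mem_inter_iff, Set.mem_image, Set.mem_ofPred_eq]
    constructor
    · rintro ⟨⟨x, hx, rfl⟩, hy⟩
      exact ⟨x, ⟨hy, hx⟩, rfl⟩
    · rintro ⟨x, ⟨hy, hx⟩, rfl⟩
      exact ⟨⟨x, hx, rfl⟩, hy⟩
  rw [cycNumber, h, Set.ncard_image_of_injective _ (add_left_injective 1),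
    Set.ncard_eq_toFinset_card', Set.toFinset_ofPred, Finset.card_filter, Nat.cast_sum]
  refine Finset.sum_congr rfl fun x _ => ?_
  simp only [Set.indicator_apply, Pi.one_apply]
  split_ifs <;> simp_all

lemma sixteen_mul_cycNumber (hq : Fintype.card F % 8 = 5)
    (hα : ∀ x : Fˣ, x ∈ Subgroup.zpowers α) (hχ : χ α = gaussI) :
    16 * (cycNumber 4 α 0 3 : ℤ) = Fintype.card F + 1 + 4 * (jacobiSum χ χ).im
      - 2 * (jacobiSum χ χ).re := by
  have key := sum_shift_quarticChar_mul hq hα hχ (one_ne_zero (α := F)) (gaussI ^ (3 * 3))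
    (gaussI ^ (2 * 3)) (gaussI ^ 3) 1 (gaussI ^ (3 * 0)) (gaussI ^ (2 * 0)) (gaussI ^ 0) 1
  simp only [← indicator_cycClass_expansion hα hχ 3 (by norm_num),
    ← indicator_cycClass_expansion hα hχ 0 (by norm_num)] at key
  rw [show gaussI ^ (3 * 3) = gaussI by decide, show gaussI ^ (2 * 3) = -1 by decide,
    show gaussI ^ 3 = - gaussI by decide, star_gaussianInt_eq, MulChar.map_one] at key
  nth_rw 1 2 [gaussianInt_eq_add_mul_gaussI (jacobiSum χ χ)] at key
  have h (x : F) : 4 * (((cycClass 4 α 3).indicator 1 (x + 1) : ℤ) : GaussianInt) *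
      (4 * (((cycClass 4 α 0).indicator 1 x : ℤ) : GaussianInt)) =
      16 * (((cycClass 4 α 3).indicator 1 (x + 1) * (cycClass 4 α 0).indicator 1 x : ℤ)
        : GaussianInt) := by
    push_cast; ring
  simp only [h, ← Finset.mul_sum, ← Int.cast_sum, ← cycNumber_eq_sum] at key
  apply intCast_gaussianInt_injective
  have hI := gaussI_sq
  push_cast at key ⊢
  linear_combination key - 4 * ((jacobiSum χ χ).im : GaussianInt) * hI

end Correlations

/-! ### Group ring identities read as conditions on correlations. -/

section GroupRing

variable {G : Type*} [Fintype G]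

lemma coeff_toGroupRing (a : G → ℤ) (g : G) : (toGroupRing a).coeff g = a g := by
  classical
  simp [toGroupRing, AddMonoidAlgebra.coeff_sum, Finsupp.single_apply]

lemma toGroupRing_injective : Function.Injective (toGroupRing : (G → ℤ) → AddMonoidAlgebra ℤ G) :=
  fun a b h => funext fun g => by rw [← coeff_toGroupRing a, h, coeff_toGroupRing]

lemma IsZeroOne.sum_abs {a : G → ℤ} (ha : IsZeroOne a) : ∑ g, |a g| = ∑ g, a g :=
  Finset.sum_congr rfl fun g _ => by rcases ha g with h | h <;> rw [h] <;> rfl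

/-- The array on `ℤ₂ × G` that is `a` on `{0} × G` and `b` on `{1} × G`. -/
def joinArray {G : Type*} (a b : G → ℤ) (x : ZMod 2 × G) : ℤ := if x.1 = 0 then a x.2 else b x.2

lemma sum_joinArray (a b : G → ℤ) : ∑ x, joinArray a b x = ∑ g, a g + ∑ g, b g := by
  rw [Fintype.sum_prod_type]
  exact Fin.sum_univ_two _

variable [AddCommGroup G]

lemma toGroupRing_add (a b : G → ℤ) :
    toGroupRing a + toGroupRing b = toGroupRing (fun g => a g + b g) := by
  simp only [toGroupRing, AddMonoidAlgebra.single_add, Finset.sum_add_distrib]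

lemma toGroupRing_sub (a b : G → ℤ) :
    toGroupRing a - toGroupRing b = toGroupRing (fun g => a g - b g) := by
  rw [sub_eq_iff_eq_add, toGroupRing_add]
  simp only [sub_add_cancel]

lemma toGroupRing_smul (c : ℤ) (a : G → ℤ) :
    c • toGroupRing a = toGroupRing (fun g => c * a g) := by
  simp only [toGroupRing, Finset.smul_sum, AddMonoidAlgebra.smul_single, smul_eq_mul]

lemma mapDomain_neg_sum (f : G → AddMonoidAlgebra ℤ G) :
    AddMonoidAlgebra.mapDomain (fun g : G => -g) (∑ g, f g) =
      ∑ g, AddMonoidAlgebra.mapDomain (fun g : G => -g) (f g) :=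
  map_sum (⟨⟨AddMonoidAlgebra.mapDomain (fun g : G => -g), AddMonoidAlgebra.mapDomain_zero _⟩,
    AddMonoidAlgebra.mapDomain_add _⟩ : AddMonoidAlgebra ℤ G →+ AddMonoidAlgebra ℤ G) _ _

lemma starInv_toGroupRing (a : G → ℤ) :
    starInv (toGroupRing a) = toGroupRing (fun g => a (-g)) := by
  rw [starInv, toGroupRing, mapDomain_neg_sum, toGroupRing,
    ← Equiv.sum_comp (Equiv.neg G)]
  simp

lemma toGroupRing_mul_starInv (a : G → ℤ) :
    toGroupRing a * starInv (toGroupRing a) = toGroupRing (autocorr a) := by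
  rw [starInv, toGroupRing, mapDomain_neg_sum, Finset.sum_mul_sum, Finset.sum_comm,
    toGroupRing]
  simp only [AddMonoidAlgebra.mapDomain_single, AddMonoidAlgebra.single_mul_single, autocorr]
  have h (h : G) : ∑ g, AddMonoidAlgebra.single (g + -h) (a g * a h) =
      ∑ t, AddMonoidAlgebra.single t (a (h + t) * a h) := by
    rw [← Equiv.sum_comp (Equiv.addLeft h)]
    simp
  simp only [h]
  rw [Finset.sum_comm]
  refine Finset.sum_congr rfl fun t _ => ?_
  exact (map_sum (AddMonoidAlgebra.singleAddHom t) _ _).symm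

lemma allG_eq_toGroupRing : allG G = toGroupRing (fun _ => 1) := rfl

lemma one_eq_toGroupRing [DecidableEq G] :
    (1 : AddMonoidAlgebra ℤ G) = toGroupRing (fun g => if g = 0 then 1 else 0) := by
  rw [toGroupRing, Finset.sum_eq_single 0]
  · simp [AddMonoidAlgebra.one_def]
  · intro b _ hb
    simp [hb]
  · simp

lemma isSymm_of_neg {a : G → ℤ} (h : ∀ g, a (-g) = a g) : IsSymm a := by
  simp only [IsSymm, starInv_toGroupRing, h]

lemma isSkew_of_add_neg {a : G → ℤ} (h0 : a 0 = 0) (h : ∀ g ≠ 0, a g + a (-g) = 1) :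
    IsSkew a := by
  classical
  right
  rw [starInv_toGroupRing, toGroupRing_add, allG_eq_toGroupRing, one_eq_toGroupRing,
    toGroupRing_sub]
  congr 1
  funext g
  by_cases hg : g = 0
  · simp [hg, h0]
  · simp [hg, h g hg]

lemma IsZeroOne.autocorr_zero {a : G → ℤ} (ha : IsZeroOne a) : autocorr a 0 = ∑ g, a g :=
  Finset.sum_congr rfl fun g _ => by rw [add_zero]; rcases ha g with h | h <;> rw [h] <;> rfl

/-- Compare coefficients. At the identity the equation is automatic, since a `{0,1}` array has
autocorrelation equal to its sum there; the given sums exclude the `(n + 1) / 2` alternative. -/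
lemma isLegendrePair_iff {a b : G → ℤ} (ha : IsZeroOne a) (hb : IsZeroOne b)
    (hsa : 2 * ∑ g, a g = Fintype.card G - 1) (hsb : 2 * ∑ g, b g = Fintype.card G - 1) :
    IsLegendrePair a b ↔
      ∀ u ≠ 0, 2 * (autocorr a u + autocorr b u) = Fintype.card G - 3 := by
  classical
  have key : toGroupRing a * starInv (toGroupRing a) + toGroupRing b * starInv (toGroupRing b) =
      (2 * (((Fintype.card G : ℤ) - 1) / 2)) • (1 : AddMonoidAlgebra ℤ G) +
        (((Fintype.card G : ℤ) - 3) / 2) • (allG G - 1) ↔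
      ∀ u ≠ 0, 2 * (autocorr a u + autocorr b u) = Fintype.card G - 3 := by
    rw [toGroupRing_mul_starInv, toGroupRing_mul_starInv, toGroupRing_add, allG_eq_toGroupRing,
      one_eq_toGroupRing, toGroupRing_sub, toGroupRing_smul, toGroupRing_smul, toGroupRing_add,
      toGroupRing_injective.eq_iff, funext_iff]
    refine forall_congr' fun u => ?_
    by_cases hu : u = 0
    · subst hu
      simp only [ne_eq, not_true_eq_false, false_imp_iff, iff_true, ha.autocorr_zero,
        hb.autocorr_zero, if_true]
      omega
    · simp only [ne_eq, hu, not_false_eq_true, forall_const, if_false]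
      omega
  rw [← key]
  refine ⟨fun h => ?_, fun h => ⟨ha, hb, by omega, Or.inr ⟨hsa, h⟩⟩⟩
  rcases h.2.2.2 with h | h
  · exact absurd h.1 (by omega)
  · exact h.2

lemma autocorr_joinArray_zero (a b : G → ℤ) (u : G) :
    autocorr (joinArray a b) (0, u) = autocorr a u + autocorr b u := by
  rw [autocorr, Fintype.sum_prod_type]
  exact Fin.sum_univ_two _

lemma autocorr_joinArray_one (a b : G → ℤ) (u : G) :
    autocorr (joinArray a b) (1, u) = ∑ g, b (g + u) * a g + ∑ g, a (g + u) * b g := by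
  rw [autocorr, Fintype.sum_prod_type]
  exact Fin.sum_univ_two _

/-- The order `2n` is `2` modulo `4`, so two values are allowed, and with `k = n - 1` they are `(n -
3) / 2` and `(n - 1) / 2`. Shifts `(0, u)` give autocorrelations, shifts `(1, u)`
cross-correlations, where `u = 0` is included. -/
lemma isPerfect_joinArray_iff {a b : G → ℤ} (ha : IsZeroOne a) (hb : IsZeroOne b)
    (hG : Odd (Fintype.card G)) (hsum : ∑ g, a g + ∑ g, b g = Fintype.card G - 1) :
    IsPerfect (joinArray a b) ↔
      (∀ u ≠ 0, 2 * (autocorr a u + autocorr b u) = Fintype.card G - 3 ∨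
        2 * (autocorr a u + autocorr b u) = Fintype.card G - 1) ∧
      ∀ u, 2 * (∑ g, b (g + u) * a g + ∑ g, a (g + u) * b g) = Fintype.card G - 3 ∨
        2 * (∑ g, b (g + u) * a g + ∑ g, a (g + u) * b g) = Fintype.card G - 1 := by
  have hz : IsZeroOne (joinArray a b) := fun x => by
    rw [joinArray]
    split_ifs
    exacts [ha _, hb _]
  have hcard : Fintype.card (ZMod 2 × G) = 2 * Fintype.card G := by
    rw [Fintype.card_prod, ZMod.card]
  have hmod : Fintype.card (ZMod 2 × G) % 4 = 2 := by
    obtain ⟨k, hk⟩ := hG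
    omega
  have hk : ∑ x, (joinArray a b x : ℚ) = Fintype.card G - 1 := by
    rw [← Int.cast_sum, sum_joinArray, hsum]
    push_cast
    rfl
  have hval (c : ℤ) : ((c : ℚ) = (Fintype.card G - 1) - ((2 * Fintype.card G : ℕ) + 2) / 4 ∨
      (c : ℚ) = (Fintype.card G - 1) - ((2 * Fintype.card G : ℕ) - 2) / 4) ↔
      (2 * c = Fintype.card G - 3 ∨ 2 * c = Fintype.card G - 1) := by
    rw [← @Int.cast_inj ℚ, ← @Int.cast_inj ℚ]
    push_cast
    refine or_congr ⟨fun h => ?_, fun h => ?_⟩ ⟨fun h => ?_, fun h => ?_⟩ <;> linarith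
  have hperfect : IsPerfect (joinArray a b) ↔ ∀ x ≠ 0,
      (2 * autocorr (joinArray a b) x = Fintype.card G - 3 ∨
        2 * autocorr (joinArray a b) x = Fintype.card G - 1) := by
    refine ⟨fun h x hx => ?_, fun h => ⟨hz, fun x hx => ⟨fun _ => by omega, fun _ => by omega,
      fun _ => ?_, fun _ => by omega⟩⟩⟩
    · rw [← hval]
      simpa only [hk, hcard] using (h.2 x hx).2.2.1 hmod
    · simp only [hk, hcard]
      exact (hval _).2 (h x hx)
  rw [hperfect]
  constructor
  · intro h
    refine ⟨fun u hu => ?_, fun u => ?_⟩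
    · rw [← autocorr_joinArray_zero]
      exact h (0, u) (by simp [hu])
    · rw [← autocorr_joinArray_one]
      exact h (1, u) (by simp)
  · rintro ⟨h0, h1⟩ ⟨i, u⟩ hne
    fin_cases i
    · have := h0 u (by rintro rfl; exact hne rfl)
      rwa [← autocorr_joinArray_zero] at this
    · have := h1 u
      rwa [← autocorr_joinArray_one] at this

end GroupRing

/-! ### Transport along the additive isomorphism. -/

section Transport

variable {F V : Type*} [Field F]

lemma isZeroOne_arrayOf (D : Set V) : IsZeroOne (arrayOf D) := fun g => by
  classical
  rw [arrayOf, Set.indicator_apply]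
  split_ifs
  exacts [Or.inr rfl, Or.inl rfl]

variable [AddCommGroup V]

lemma arrayOf_image (φ : F ≃+ V) (S : Set F) :
    arrayOf (φ '' S) = fun v => S.indicator (1 : F → ℤ) (φ.symm v) := by
  classical
  funext v
  simp only [arrayOf, Set.indicator_apply, Pi.one_apply]
  congr 1
  rw [← φ.apply_symm_apply v, φ.injective.mem_set_image, φ.apply_symm_apply]

variable [Fintype F] [Fintype V]

lemma sum_shift_comp_symm (φ : F ≃+ V) (f g : F → ℤ) (v : V) :
    ∑ w, f (φ.symm (w + v)) * g (φ.symm w) = ∑ x, f (x + φ.symm v) * g x := by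
  rw [← Equiv.sum_comp φ.toEquiv]
  simp

lemma sum_comp_symm (φ : F ≃+ V) (f : F → ℤ) : ∑ w, f (φ.symm w) = ∑ x, f x :=
  Equiv.sum_comp φ.symm.toEquiv f

end Transport

/-! ### The conditions in terms of the real and imaginary parts of the Jacobi sum. -/

section Main

variable {F V : Type*} [Field F] [Fintype F] [AddCommGroup V] [Fintype V] {α : Fˣ}
  {χ : MulChar F GaussianInt} {e : ℤ} {P Q : F → ℤ}

lemma four_mul_autocorr_add (hq : Fintype.card F % 8 = 5)
    (hα : ∀ x : Fˣ, x ∈ Subgroup.zpowers α) (hχ : χ α = gaussI) (he : e ^ 2 = 1)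
    (hP : HasSkewExpansion χ e P) (hQ : HasSymmExpansion χ e Q) (φ : F ≃+ V) {v : V}
    (hv : v ≠ 0) :
    4 * (autocorr (fun v => P (φ.symm v)) v + autocorr (fun v => Q (φ.symm v)) v) =
      2 * (Fintype.card F - 3) - (χ (φ.symm v) ^ 2).re * ((jacobiSum χ χ).im + 2 * e) := by
  have hu : φ.symm v ≠ 0 := by simpa using hv
  rw [autocorr, autocorr, sum_shift_comp_symm φ P P, sum_shift_comp_symm φ Q Q, mul_add,
    sum_skew_mul_skew hq hα hχ he hP hu, sum_symm_mul_symm hq hα hχ he hQ hu]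
  ring

lemma two_mul_cross_sum (hq : Fintype.card F % 8 = 5)
    (hα : ∀ x : Fˣ, x ∈ Subgroup.zpowers α) (hχ : χ α = gaussI) (he : e = 1 ∨ e = -1)
    (hP : HasSkewExpansion χ e P) (hQ : HasSymmExpansion χ e Q) (φ : F ≃+ V) (v : V) :
    2 * (∑ w, P (φ.symm (w + v)) * Q (φ.symm w) + ∑ w, Q (φ.symm (w + v)) * P (φ.symm w)) =
        Fintype.card F - 3 ∨
      2 * (∑ w, P (φ.symm (w + v)) * Q (φ.symm w) + ∑ w, Q (φ.symm (w + v)) * P (φ.symm w)) =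
        Fintype.card F - 1 := by
  rw [sum_shift_comp_symm φ P Q, sum_shift_comp_symm φ Q P]
  -- At shift zero both sums count the intersection of the two sets, of size `(q - 1) / 4`, giving
  -- the upper value.
  rcases eq_or_ne (φ.symm v) 0 with hu | hu
  · right
    have h := sum_skew_mul_symm hα hχ hP hQ
    simp only [hu, add_zero, mul_comm (Q _)]
    linarith
  · rw [sum_skew_mul_symm_add hq hα hχ hP hQ hu]
    rcases he with rfl | rfl <;> rcases (quarticChar_sq_eq hα hχ hu).2 with h | h <;> rw [h] <;>
      omega

lemma flat_iff (hq : Fintype.card F % 8 = 5)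
    (hα : ∀ x : Fˣ, x ∈ Subgroup.zpowers α) (hχ : χ α = gaussI) (he : e ^ 2 = 1)
    (hP : HasSkewExpansion χ e P) (hQ : HasSymmExpansion χ e Q) (φ : F ≃+ V) :
    (∀ v ≠ 0, 2 * (autocorr (fun v => P (φ.symm v)) v + autocorr (fun v => Q (φ.symm v)) v) =
      Fintype.card F - 3) ↔ (jacobiSum χ χ).im = -2 * e := by
  constructor
  · intro h
    have h1 : φ 1 ≠ 0 := by simp
    have := four_mul_autocorr_add hq hα hχ he hP hQ φ h1
    rw [φ.symm_apply_apply, MulChar.map_one, one_pow, Zsqrtd.re_one] at this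
    linarith [h _ h1]
  · intro h v hv
    have := four_mul_autocorr_add hq hα hχ he hP hQ φ hv
    rw [h] at this
    linarith

/-- The two-valued condition allows `-χ(u)²(Y + 2e)` to be `0` or `4`. Testing at `1` and at `α`,
where `χ²` is `1` and `-1`, rules out `4`. -/
lemma nearly_flat_iff (hq : Fintype.card F % 8 = 5)
    (hα : ∀ x : Fˣ, x ∈ Subgroup.zpowers α) (hχ : χ α = gaussI) (he : e ^ 2 = 1)
    (hP : HasSkewExpansion χ e P) (hQ : HasSymmExpansion χ e Q) (φ : F ≃+ V) :
    (∀ v ≠ 0, 2 * (autocorr (fun v => P (φ.symm v)) v + autocorr (fun v => Q (φ.symm v)) v) =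
      Fintype.card F - 3 ∨ 2 * (autocorr (fun v => P (φ.symm v)) v +
        autocorr (fun v => Q (φ.symm v)) v) = Fintype.card F - 1) ↔
      (jacobiSum χ χ).im = -2 * e := by
  constructor
  · intro h
    have h1 : φ 1 ≠ 0 := by simp
    have hα0 : φ (α : F) ≠ 0 := by simp
    have e1 := four_mul_autocorr_add hq hα hχ he hP hQ φ h1
    have e2 := four_mul_autocorr_add hq hα hχ he hP hQ φ hα0
    rw [φ.symm_apply_apply, MulChar.map_one, one_pow, Zsqrtd.re_one] at e1
    rw [φ.symm_apply_apply, hχ, show (gaussI ^ 2).re = -1 by decide] at e2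
    rcases h _ h1 with h1 | h1 <;> rcases h _ hα0 with h2 | h2 <;> linarith
  · intro h v hv
    exact Or.inl ((flat_iff hq hα hχ he hP hQ φ).2 h v hv)

lemma tOf_eq_iff (hq : Fintype.card F % 8 = 5)
    (hα : ∀ x : Fˣ, x ∈ Subgroup.zpowers α) (hχ : χ α = gaussI) {s : ℤ}
    (hs : (jacobiSum χ χ).re = -s) (c : ℤ) : tOf α s = c ↔ (jacobiSum χ χ).im = 2 * c := by
  have h : (16 : ℚ) * (cycNumber 4 α 0 3 : ℚ) = Fintype.card F + 1 + 4 * (jacobiSum χ χ).im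
      - 2 * (jacobiSum χ χ).re := by
    exact_mod_cast sixteen_mul_cycNumber hq hα hχ
  rw [tOf, h, hs, Nat.card_eq_fintype_card, ← @Int.cast_inj ℚ]
  push_cast
  constructor <;> intro h <;> linarith

/-- Uniqueness of proper representations gives `X = ±s`. The sign comes from the cyclotomic number:
`16 (0,3) = q + 1 + 4Y - 2X` with `Y` even and `q ≡ 5 (mod 8)` forces `X ≡ 3 (mod 4)`, whereas `s ≡
1`. -/
lemma jacobiSum_re_eq {p m : ℕ} (hp : p.Prime) [CharP F p] (hF : Fintype.card F = p ^ m)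
    (hq : p ^ m % 8 = 5) (hα : ∀ x : Fˣ, x ∈ Subgroup.zpowers α) (hχ : χ α = gaussI)
    {s t : ℤ} (hst : (p : ℤ) ^ m = s ^ 2 + 4 * t ^ 2) (hproper : Int.gcd ((p : ℤ) ^ m) s = 1)
    (hs : s ≡ 1 [ZMOD 4]) : (jacobiSum χ χ).re = -s := by
  have h16 := sixteen_mul_cycNumber (hF ▸ hq) hα hχ
  have hnorm := jacobiSum_norm hα hχ
  have hnd := not_dvd_jacobiSum hp hF hq hα hχ
  have hm : m ≠ 0 := by rintro rfl; simp at hq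
  have hp4 := mod_four_eq_one_of_pow_mod_eight hq
  have hpZ := Nat.prime_iff_prime_int.1 hp
  have hcard : (Fintype.card F : ℤ) % 8 = 5 := by rw [hF]; exact_mod_cast hq
  have hs4 : s % 4 = 1 := hs
  set X := (jacobiSum χ χ).re
  set Y := (jacobiSum χ χ).im
  have hX : Odd X := by rw [Int.odd_iff]; omega
  have hY : Even Y := by
    by_contra hY
    have := (hX.pow (n := 2)).add_odd ((Int.not_even_iff_odd.1 hY).pow (n := 2))
    rw [← hnorm, Int.even_iff] at this
    omega
  have hX4 : X % 4 = 3 := by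
    obtain ⟨y, hy⟩ := hY
    omega
  have hsq : s ^ 2 = X ^ 2 := by
    refine sq_eq_sq_of_proper_representations hpZ (m := m) (b := 2 * t) (d := Y) ?_ ?_ ?_ hm ?_
      hnd ?_ (even_two_mul t) hX
    · intro h
      have := Int.le_of_dvd two_pos h
      have := hp.two_le
      omega
    · rw [hst]; ring
    · rw [← hnorm, hF, Nat.cast_pow]
    · intro h
      have := Int.dvd_coe_gcd (dvd_pow_self (p : ℤ) hm) h
      rw [hproper] at this
      exact hpZ.not_isUnit (isUnit_of_dvd_one (by exact_mod_cast this))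
    · rw [Int.odd_iff]; omega
  rcases sq_eq_sq_iff_eq_or_eq_neg.1 hsq with h | h <;> omega

end Main

/-! ### Perfectness and the Yamada–Pott property as one condition on the Jacobi sum. -/

section Equivalence

variable {F : Type*} [Field F] {p m : ℕ} {α : Fˣ}

lemma dhmS_eq_joinArray (φ : F ≃+ (Fin m → ZMod p)) (α : Fˣ) (i : ℕ) :
    dhmS φ α i = joinArray (dhmA φ α i) (dhmB φ α i) := by
  classical
  funext ⟨j, v⟩
  simp only [dhmS, dhmA, dhmB, joinArray, arrayOf, Set.indicator_apply, Pi.one_apply]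
  have hj : ∀ j : ZMod 2, j = 0 ∨ j = 1 := by decide
  rcases hj j with rfl | rfl <;> simp

lemma tfae_dhm_of_expansions [Fintype F] [Fact p.Prime] {χ : MulChar F GaussianInt}
    (hF : Fintype.card F = p ^ m) (hq : p ^ m % 8 = 5) (φ : F ≃+ (Fin m → ZMod p))
    (hα : ∀ x : Fˣ, x ∈ Subgroup.zpowers α) (hχ : χ α = gaussI) {i : ℕ} {e : ℤ}
    (he : e = 1 ∨ e = -1)
    (hAB : HasSkewExpansion χ e ((dhmSets α i).1.indicator 1) ∧
        HasSymmExpansion χ e ((dhmSets α i).2.indicator 1) ∨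
      HasSymmExpansion χ e ((dhmSets α i).1.indicator 1) ∧
        HasSkewExpansion χ e ((dhmSets α i).2.indicator 1)) :
    (IsPerfect (dhmS φ α i) ↔ (jacobiSum χ χ).im = -2 * e) ∧
      (IsYamadaPottPair (dhmA φ α i) (dhmB φ α i) ↔ (jacobiSum χ χ).im = -2 * e) := by
  have hqF : Fintype.card F % 8 = 5 := hF ▸ hq
  have hcard : Fintype.card (Fin m → ZMod p) = Fintype.card F :=
    (Fintype.card_congr φ.toEquiv).symm
  have he2 : e ^ 2 = 1 := by rcases he with rfl | rfl <;> rfl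
  have hodd : Odd (Fintype.card (Fin m → ZMod p)) := by
    rw [hcard, Nat.odd_iff]
    omega
  have hza : IsZeroOne (dhmA φ α i) := isZeroOne_arrayOf _
  have hzb : IsZeroOne (dhmB φ α i) := isZeroOne_arrayOf _
  have eA : dhmA φ α i = fun v => (dhmSets α i).1.indicator (1 : F → ℤ) (φ.symm v) :=
    arrayOf_image φ _
  have eB : dhmB φ α i = fun v => (dhmSets α i).2.indicator (1 : F → ℤ) (φ.symm v) :=
    arrayOf_image φ _
  rw [dhmS_eq_joinArray]
  generalize dhmA φ α i = a at *
  generalize dhmB φ α i = b at *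
  generalize (dhmSets α i).1.indicator (1 : F → ℤ) = f at *
  generalize (dhmSets α i).2.indicator (1 : F → ℤ) = g at *
  have hsa : 2 * ∑ v, a v = Fintype.card (Fin m → ZMod p) - 1 := by
    rw [hcard, eA, sum_comp_symm]
    rcases hAB with h | h
    exacts [sum_skew hα hχ h.1, sum_symm hα hχ h.1]
  have hsb : 2 * ∑ v, b v = Fintype.card (Fin m → ZMod p) - 1 := by
    rw [hcard, eB, sum_comp_symm]
    rcases hAB with h | h
    exacts [sum_symm hα hχ h.2, sum_skew hα hχ h.2]
  have hflat : (∀ v ≠ 0, 2 * (autocorr a v + autocorr b v) = Fintype.card F - 3) ↔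
      (jacobiSum χ χ).im = -2 * e := by
    rw [eA, eB]
    rcases hAB with h | h
    · exact flat_iff hqF hα hχ he2 h.1 h.2 φ
    · simp only [add_comm (autocorr (fun v => f (φ.symm v)) _)]
      exact flat_iff hqF hα hχ he2 h.2 h.1 φ
  have hnear : (∀ v ≠ 0, 2 * (autocorr a v + autocorr b v) = Fintype.card F - 3 ∨
      2 * (autocorr a v + autocorr b v) = Fintype.card F - 1) ↔
      (jacobiSum χ χ).im = -2 * e := by
    rw [eA, eB]
    rcases hAB with h | h
    · exact nearly_flat_iff hqF hα hχ he2 h.1 h.2 φ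
    · simp only [add_comm (autocorr (fun v => f (φ.symm v)) _)]
      exact nearly_flat_iff hqF hα hχ he2 h.2 h.1 φ
  have hcross (v : Fin m → ZMod p) :
      2 * (∑ w, b (w + v) * a w + ∑ w, a (w + v) * b w) = Fintype.card F - 3 ∨
        2 * (∑ w, b (w + v) * a w + ∑ w, a (w + v) * b w) = Fintype.card F - 1 := by
    rw [eA, eB]
    rcases hAB with h | h
    · rw [add_comm (∑ w, _)]
      exact two_mul_cross_sum hqF hα hχ he h.1 h.2 φ v
    · exact two_mul_cross_sum hqF hα hχ he h.2 h.1 φ v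
  have hsymm {Q : F → ℤ} (hQ : HasSymmExpansion χ e Q) : IsSymm (fun v => Q (φ.symm v)) :=
    isSymm_of_neg fun v => by rw [map_neg, hQ.neg_apply hqF hα hχ]
  have hskew {P : F → ℤ} (hP : HasSkewExpansion χ e P) : IsSkew (fun v => P (φ.symm v)) := by
    refine isSkew_of_add_neg (by rw [map_zero, hP.apply_zero]) fun v hv => ?_
    rw [map_neg, hP.add_neg_apply hqF hα hχ (by simpa using hv)]
  constructor
  · rw [isPerfect_joinArray_iff hza hzb hodd (by linarith), hcard, ← hnear]
    exact and_iff_left hcross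
  · rw [IsYamadaPottPair, isLegendrePair_iff hza hzb hsa hsb, hcard, ← hflat]
    refine and_iff_left ⟨?_, ?_⟩
    · rw [hza.sum_abs, hzb.sum_abs]
      linarith
    · rw [eA, eB]
      rcases hAB with h | h
      exacts [Or.inr ⟨hskew h.1, hsymm h.2⟩, Or.inl ⟨hsymm h.1, hskew h.2⟩]

end Equivalence

end GArrays

theorem mainTheorem1 (p m : ℕ) [Fact p.Prime] (hq : p ^ m % 8 = 5)
    {F : Type*} [Field F] [Finite F] (φ : F ≃+ (Fin m → ZMod p))
    (α : Fˣ) (hα : ∀ x : Fˣ, x ∈ Subgroup.zpowers α)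
    (s t : ℤ) (hst : (p : ℤ) ^ m = s ^ 2 + 4 * t ^ 2)
    (hproper : Int.gcd ((p : ℤ) ^ m) s = 1) (hs : s ≡ 1 [ZMOD 4])
    (i : ℕ) (hi : i = 1 ∨ i = 2) :
    List.TFAE
      [GArrays.IsPerfect (GArrays.dhmS φ α i),
       GArrays.IsYamadaPottPair (GArrays.dhmA φ α i) (GArrays.dhmB φ α i),
       GArrays.tOf α s = (-1) ^ (i + 1)] := by
  have : Fintype F := Fintype.ofFinite F
  have hp : p.Prime := Fact.out
  have hF : Fintype.card F = p ^ m := by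
    rw [Fintype.card_congr φ.toEquiv, Fintype.card_fun, ZMod.card, Fintype.card_fin]
  have hqF : Fintype.card F % 8 = 5 := hF ▸ hq
  have hchar : CharP F p := by
    refine (CharP.charP_iff_prime_eq_zero hp).2 (φ.injective ?_)
    rw [map_zero, ← nsmul_one, map_nsmul]
    funext j
    simp
  obtain ⟨χ, hχ⟩ := GArrays.exists_quarticChar hqF hα
  have hre := GArrays.jacobiSum_re_eq hp hF hq hα hχ hst hproper hs
  suffices h : (GArrays.IsPerfect (GArrays.dhmS φ α i) ↔
        (jacobiSum χ χ).im = -2 * (-1) ^ i) ∧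
      (GArrays.IsYamadaPottPair (GArrays.dhmA φ α i) (GArrays.dhmB φ α i) ↔
        (jacobiSum χ χ).im = -2 * (-1) ^ i) by
    have ht := GArrays.tOf_eq_iff hqF hα hχ hre ((-1) ^ (i + 1))
    rw [show (2 : ℤ) * (-1) ^ (i + 1) = -2 * (-1) ^ i by ring] at ht
    push_cast at ht
    tfae_have 1 ↔ 3 := h.1.trans ht.symm
    tfae_have 2 ↔ 3 := h.2.trans ht.symm
    tfae_finish
  -- The sign is `e = (-1)^i`: for `i = 1` the first array is the skew one, for `i = 2` the second.
  rcases hi with rfl | rfl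
  · exact GArrays.tfae_dhm_of_expansions hF hq φ hα hχ (Or.inr rfl)
      (Or.inl ⟨GArrays.indicator_one_skew hα hχ, GArrays.indicator_one_symm hα hχ⟩)
  · exact GArrays.tfae_dhm_of_expansions hF hq φ hα hχ (Or.inl rfl)
      (Or.inr ⟨GArrays.indicator_two_symm hα hχ, GArrays.indicator_two_skew hα hχ⟩)
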